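/- Consider $n\ge 1$ stores trading in a market over periods $t=1,\dots,T$. Store $j$ has a capacity $E_j\ge 0$, input and output rate limits $P_{Ij},P_{Oj}\ge 0$, an efficiency $\epsilon_j\in(0,1]$, and prescribed initial and final levels $S^*_{j0},S^*_{jT}$. A policy of store $j$ is a vector of levels $S_j=(S_{j0},\dots,S_{jT})$; write $x_t(S_j)=S_{jt}-S_{j,t-1}$. The policy is feasible if $S_{j0}=S^*_{j0}$, $S_{jT}=S^*_{jT}$, $0\le S_{jt}\le E_j$ for $1\le t\le T-1$, and $-P_{Oj}\le x_t(S_j)\le P_{Ij}$ for $1\le t\le T$. Assume that every store has at least one feasible policy. Put $h_j(x)=x$ for $x\ge 0$ and $h_j(x)=\epsilon_j x$ for $x<0$ (the energy bought from the market when the level of store $j$ changes by $x$). If the stores use policies $S_1,\dots,S_n$, the total cost to store $j$ is $$G_j(S_1,\dots,S_n)=\sum_{t=1}^T h_j(x_t(S_j))\,p_t\Big(\sum_{i=1}^n h_i(x_t(S_i))\Big),$$ where $p_t$ is the price function of period $t$. Let $I=\big[-\sum_{i}\epsilon_iP_{Oi},\ \sum_{i}P_{Ii}\big]$ and assume that,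 for every $t$: 1. $p_t$ is positive and (weakly) increasing on $I$; 2. for every store $j$ and every constant $k\in\big[-\sum_{i\ne j}\epsilon_iP_{Oi},\ \sum_{i\ne j}P_{Ii}\big]$ (a possible total purchase of the other stores), the function $x\mapsto x\,p_t(x+k)$ is convex and (weakly) increasing on $[-\epsilon_jP_{Oj},P_{Ij}]$; 3. $p_t$, as a function on $I$, is continuous at the right end point $\sum_i P_{Ii}$ of $I$. Then there is at least one pure-strategy Nash (Cournot) equilibrium, that is, a tuple $(S_1,\dots,S_n)$ of feasible policies such that, for every $j$, $S_j$ minimises $G_j(S_1,\dots,S_{j-1},\,\cdot\,,S_{j+1},\dots,S_n)$ over the feasible policies of store $j$. -/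

import Mathlib

open scoped BigOperators

/-- The data of one store: capacity, input and output rate constraints, efficiency, and the
prescribed initial and final levels. -/
structure Store where
  capacity : ℝ
  inputRate : ℝ
  outputRate : ℝ
  efficiency : ℝ
  initialLevel : ℝ
  finalLevel : ℝ
  capacity_nonneg : 0 ≤ capacity
  inputRate_nonneg : 0 ≤ inputRate
  outputRate_nonneg : 0 ≤ outputRate
  efficiency_pos : 0 < efficiency
  efficiency_le_one : efficiency ≤ 1

/-- The change of level `x_t(S) = S_t - S_{t-1}` in each of the `T` periods. A policy over `T` periods
is a vector of `T + 1` levels; the periods `1, …, T` are indexed by `Fin T`, so that the period with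
index `t` leads from the level with index `t.castSucc` to the level with index `t.succ`. -/
def levelChange {T : ℕ} (S : Fin (T + 1) → ℝ) (t : Fin T) : ℝ :=
  S t.succ - S t.castSucc

namespace Store

/-- The amount of energy bought from the market (sold, if negative) when the level of the store
changes by `x`. -/
noncomputable def traded (s : Store) (x : ℝ) : ℝ :=
  if 0 ≤ x then x else s.efficiency * x

/-- The policies that satisfy the boundary, capacity and rate constraints of the store. -/
def feasible (s : Store) (T : ℕ) : Set (Fin (T + 1) → ℝ) :=
  {S | S 0 = s.initialLevel ∧ S (Fin.last T) = s.finalLevel ∧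
    (∀ t : Fin (T + 1), t ≠ 0 → t ≠ Fin.last T → S t ∈ Set.Icc 0 s.capacity) ∧
    ∀ t : Fin T, levelChange S t ∈ Set.Icc (-s.outputRate) s.inputRate}

end Store

/-- The range of the possible total amounts that a group `A` of stores can buy in one period. -/
def tradeRange {n : ℕ} (store : Fin n → Store) (A : Finset (Fin n)) : Set ℝ :=
  Set.Icc (-∑ i ∈ A, (store i).efficiency * (store i).outputRate) (∑ i ∈ A, (store i).inputRate)

/-- The standing assumptions on a price function `p`: on the range of the possible total purchases it
is positive and increasing, and the total cost `x * p (x + k)` to store `j` of buying `x` units, when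
the remaining stores buy `k` units in total, is a convex and increasing function of `x`, for each `k`
that these stores can buy. -/
structure PriceAssumptions {n : ℕ} (store : Fin n → Store) (p : ℝ → ℝ) : Prop where
  pos : ∀ y ∈ tradeRange store Finset.univ, 0 < p y
  mono : MonotoneOn p (tradeRange store Finset.univ)
  cost_convex : ∀ j, ∀ k ∈ tradeRange store (Finset.univ.erase j),
    ConvexOn ℝ (tradeRange store {j}) (fun x => x * p (x + k))
  cost_mono : ∀ j, ∀ k ∈ tradeRange store (Finset.univ.erase j),
    MonotoneOn (fun x => x * p (x + k)) (tradeRange store {j})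

/-- The cost to store `j`, in a period with price function `p`, when the levels of the stores change
by the amounts `x i`. -/
noncomputable def periodCost {n : ℕ} (store : Fin n → Store) (p : ℝ → ℝ) (j : Fin n)
    (x : Fin n → ℝ) : ℝ :=
  (store j).traded (x j) * p (∑ i, (store i).traded (x i))

/-- The total cost to store `j` over all periods, when each store `i` uses the policy `S i`. -/
noncomputable def totalCost {n T : ℕ} (store : Fin n → Store) (p : Fin T → ℝ → ℝ) (j : Fin n)
    (S : Fin n → Fin (T + 1) → ℝ) : ℝ :=
  ∑ t, periodCost store (p t) j (fun i => levelChange (S i) t)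

/-- A (pure strategy) Nash equilibrium: the policy of every store is feasible, and minimises the total
cost to this store over its feasible policies, given the policies of the remaining stores. -/
def IsNashEquilibrium {n T : ℕ} (store : Fin n → Store) (p : Fin T → ℝ → ℝ)
    (S : Fin n → Fin (T + 1) → ℝ) : Prop :=
  ∀ j, S j ∈ (store j).feasible T ∧
    ∀ R ∈ (store j).feasible T,
      totalCost store p j S ≤ totalCost store p j (Function.update S j R)

/-!
The feasible policies of a store form a compact convex set, and the cost to a store is convex in
its own policy, because the amount traded is a convex function of the change of level and the cost
of trading is convex and increasing (`convexOn_totalCost_update`). The costs are jointly continuous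
in all policies (`continuousOn_totalCost`). The price itself may jump, but only at total purchases
to which no store contributes: if a store contributes a non-zero amount, interior to its range,
then convexity of `x * p (x + k)` in `x` gives continuity, and an amount at an end point of the
range can be made interior by shifting part of it to the other stores, except at the two end points
of the whole range. At the upper one continuity is assumed, at the lower one it follows from
monotonicity (`PriceAssumptions.continuousWithinAt`). At a jump of the price all costs vanish, and
they are continuous there since the price is bounded (`PriceAssumptions.continuousOn_cost`).

A game with such costs has an equilibrium (`exists_equilibrium_of_convexOn`), by Ky Fan's
inequality `exists_forall_le_zero_of_concaveOn` for the Nikaido–Isoda function. Ky Fan's inequality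
reduces, by compactness, to the following form of Brouwer's theorem,
`Scarf.exists_mem_stdSimplex_forall_le`: for continuous functions `g i` on a simplex there is a
point `x` such that each `i` with `x i ≠ 0` maximises `g i x`. This is the limit of Scarf's lemma
(`Scarf.exists_dominated_image_eq_univ`), a variant of Sperner's lemma in which sets that are not
strictly exceeded in all coordinates take the place of the cells of a triangulation. It is proved
by parity: a set with one element less than a cell lies in none or two of the cells, except for one
outer face, which lies in a single one. -/

/-! ### Scarf's lemma -/

namespace Scarf

variable {I X : Type*} {r : I → X → ℕ}

/-- A set `σ` is *dominated* by `X`, with respect to the orders given by the ranks `r i`, if no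
element of `X` lies strictly above the `r i`-least element of `σ` for every `i`. -/
def Dominated (r : I → X → ℕ) (σ : Finset X) : Prop :=
  ∀ y, ∃ i, ∀ x ∈ σ, r i y ≤ r i x

theorem Dominated.subset {σ τ : Finset X} (h : Dominated r σ) (hτ : τ ⊆ σ) : Dominated r τ :=
  fun y => (h y).imp fun _ hi x hx => hi x (hτ hx)

theorem exists_argmin (r : I → X → ℕ) {τ : Finset X} (hτ : τ.Nonempty) :
    ∃ a : I → X, (∀ i, a i ∈ τ) ∧ ∀ i, ∀ x ∈ τ, r i (a i) ≤ r i x := by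
  choose a ha using fun i => Finset.exists_min_image τ (r i) hτ
  exact ⟨a, fun i => (ha i).1, fun i => (ha i).2⟩

theorem Dominated.exists_argmin_eq (hr : ∀ i, Function.Injective (r i)) {τ : Finset X}
    (hd : Dominated r τ) {a : I → X} (ha : ∀ i, a i ∈ τ) (hmin : ∀ i, ∀ x ∈ τ, r i (a i) ≤ r i x)
    {y : X} (hy : y ∈ τ) : ∃ i, a i = y := by
  obtain ⟨i, hi⟩ := hd y
  exact ⟨i, hr i (le_antisymm (hmin i y hy) (hi _ (ha i)))⟩

/-- The elements that may replace the `r k`-least element of a set without being stopped by an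
index other than `k`: they lie strictly above the least element `a l` for each `l ≠ k`. -/
def Above (r : I → X → ℕ) (a : I → X) (k : I) (y : X) : Prop :=
  ∀ l, l ≠ k → r l (a l) < r l y

variable [DecidableEq X]

/-- An element that is largest, in the order of `k`, among those that meet the condition `Above`
for `k` completes a dominated set. -/
theorem dominated_insert_of_above {τ : Finset X} (hd : Dominated r τ) {a : I → X}
    (ha : ∀ i, a i ∈ τ) (hmin : ∀ i, ∀ x ∈ τ, r i (a i) ≤ r i x) {k : I} {x : X}
    (hx : Above r a k x) (hmax : ∀ y, Above r a k y → r k y ≤ r k x) :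
    Dominated r (insert x τ) := by
  intro y
  by_cases hy : Above r a k y
  · refine ⟨k, fun z hz => ?_⟩
    rcases Finset.mem_insert.1 hz with rfl | hz
    · exact hmax y hy
    · obtain ⟨l, hl⟩ := hd x
      have : l = k := by
        by_contra h
        exact absurd (hl _ (ha l)) (not_le.2 (hx l h))
      subst this
      exact (hmax y hy).trans (hl z hz)
  · simp only [Above, not_forall, not_lt] at hy
    obtain ⟨l, hlk, hl⟩ := hy
    refine ⟨l, fun z hz => ?_⟩
    rcases Finset.mem_insert.1 hz with rfl | hz
    · exact hl.trans (hx l hlk).le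
    · exact hl.trans (hmin l z hz)

/-- Conversely, a completing element becomes the new least element for some index `k`, and the
other indices keep their least elements, which are then distinct. -/
theorem exists_above_of_dominated_insert [Fintype I] (hr : ∀ i, Function.Injective (r i))
    {τ : Finset X} (hcard : τ.card + 1 = Fintype.card I) {a : I → X}
    (ha : ∀ i, a i ∈ τ) (hmin : ∀ i, ∀ x ∈ τ, r i (a i) ≤ r i x) {x : X} (hx : x ∉ τ)
    (hd : Dominated r (insert x τ)) :
    ∃ k, Above r a k x ∧ (∀ y, Above r a k y → r k y ≤ r k x) ∧
      ∀ l l', l ≠ k → l' ≠ k → a l = a l' → l = l' := by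
  classical
  have hne : ∀ l, ∀ z ∈ τ, r l z ≠ r l x := fun l z hz h => hx (hr l h ▸ hz)
  obtain ⟨k, hk⟩ := hd x
  have hkx : ∀ z ∈ τ, r k x < r k z := fun z hz =>
    lt_of_le_of_ne (hk z (Finset.mem_insert_of_mem hz)) (hne k z hz).symm
  choose l hl using hd
  have hlk : ∀ y ∈ τ, l y ≠ k := by
    intro y hy h
    have := hl y x (Finset.mem_insert_self _ _)
    rw [h] at this
    exact absurd this (not_le.2 (hkx y hy))
  have hal : ∀ y ∈ τ, a (l y) = y := fun y hy =>
    hr (l y) (le_antisymm (hmin _ y hy) (hl y _ (Finset.mem_insert_of_mem (ha _))))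
  -- By counting, `l` maps `τ` onto the indices other than `k`.
  have himg : τ.image l = Finset.univ.erase k := by
    apply Finset.eq_of_subset_of_card_le
    · intro i hi
      obtain ⟨y, hy, rfl⟩ := Finset.mem_image.1 hi
      exact Finset.mem_erase.2 ⟨hlk y hy, Finset.mem_univ _⟩
    · rw [Finset.card_erase_of_mem (Finset.mem_univ _), Finset.card_univ,
        Finset.card_image_of_injOn]
      · omega
      · intro y hy y' hy' h
        rw [← hal y hy, ← hal y' hy', h]
  have hsurj : ∀ i, i ≠ k → ∃ y ∈ τ, l y = i := fun i hi => by
    have : i ∈ τ.image l := himg ▸ Finset.mem_erase.2 ⟨hi, Finset.mem_univ _⟩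
    simpa using this
  refine ⟨k, fun i hi => ?_, fun y hy => ?_, fun i i' hi hi' h => ?_⟩
  · obtain ⟨y, hy, rfl⟩ := hsurj i hi
    rw [hal y hy]
    exact lt_of_le_of_ne (hl y x (Finset.mem_insert_self _ _)) (hne _ y hy)
  · have : l y = k := by
      by_contra h
      exact absurd (hl y _ (Finset.mem_insert_of_mem (ha (l y)))) (not_le.2 (hy _ h))
    rw [← this]
    exact hl y x (Finset.mem_insert_self _ _)
  · obtain ⟨y, hy, rfl⟩ := hsurj i hi
    obtain ⟨y', hy', rfl⟩ := hsurj i' hi'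
    rw [hal y hy, hal y' hy'] at h
    rw [h]

/-- A set with one element less than there are indices, and for which the conditions `Above` can be
met, lies in exactly two or none of the dominated sets with one more element. Indeed, two indices
`i ≠ j` share their least element, and an additional element has to become the new least element
for `i` or for `j`, where it must be the largest element that meets the condition `Above`. -/
theorem even_card_dominated_insert [Fintype I] [Fintype X] (hr : ∀ i, Function.Injective (r i))
    {τ : Finset X} (hτ : τ.Nonempty) (hcard : τ.card + 1 = Fintype.card I)
    (habove : ∀ a : I → X, (∀ i, a i ∈ τ) → (∀ i, ∀ x ∈ τ, r i (a i) ≤ r i x) →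
      ∀ k, ∃ y, Above r a k y)
    (s : Finset X) (hs : ∀ x, x ∈ s ↔ x ∉ τ ∧ Dominated r (insert x τ)) : Even s.card := by
  classical
  by_cases hd : Dominated r τ
  swap
  · have : s = ∅ := Finset.eq_empty_of_forall_notMem fun x hx =>
      hd (((hs x).1 hx).2.subset (Finset.subset_insert _ _))
    simp [this]
  obtain ⟨a, ha, hmin⟩ := exists_argmin r hτ
  obtain ⟨i, -, j, -, hij, haij⟩ := Finset.exists_ne_map_eq_of_card_lt_of_maps_to
    (s := Finset.univ) (t := τ) (f := a) (by rw [Finset.card_univ]; omega) (fun i _ => ha i)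
  have hmax : ∀ k, ∃ x, Above r a k x ∧ ∀ y, Above r a k y → r k y ≤ r k x := fun k => by
    obtain ⟨y, hy⟩ := habove a ha hmin k
    obtain ⟨x, hx, hx'⟩ := Finset.exists_max_image (Finset.univ.filter (Above r a k)) (r k)
      ⟨y, by simpa using hy⟩
    exact ⟨x, by simpa using hx, fun y hy => hx' y (by simpa using hy)⟩
  -- Every element of `τ` is the least element for an index other than `k`, for `k = i` and `k = j`.
  have hnot : ∀ k k', k ≠ k' → a k = a k' → ∀ x, Above r a k x → x ∉ τ := by
    intro k k' hkk' hak x hx hxτ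
    obtain ⟨l, rfl⟩ := hd.exists_argmin_eq hr ha hmin hxτ
    by_cases hl : l = k
    · subst hl
      have := hx k' hkk'.symm
      rw [hak] at this
      exact lt_irrefl _ this
    · exact lt_irrefl _ (hx l hl)
  obtain ⟨x, hx, hxm⟩ := hmax i
  obtain ⟨y, hy, hym⟩ := hmax j
  have hxy : x ≠ y := by
    rintro rfl
    obtain ⟨l, hl⟩ := hd x
    refine absurd (hl _ (ha l)) (not_le.2 ?_)
    by_cases h : l = i
    · exact hy l (h ▸ hij)
    · exact hx l h
  have : s = {x, y} := by
    ext z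
    rw [hs, Finset.mem_insert, Finset.mem_singleton]
    constructor
    · rintro ⟨hz, hdz⟩
      obtain ⟨k, hk, hkm, hinj⟩ := exists_above_of_dominated_insert hr hcard ha hmin hz hdz
      by_cases hki : i = k
      · subst hki
        exact Or.inl (hr _ (le_antisymm (hxm z hk) (hkm x hx)))
      by_cases hkj : j = k
      · subst hkj
        exact Or.inr (hr _ (le_antisymm (hym z hk) (hkm y hy)))
      exact absurd (hinj i j hki hkj haij) hij
    · rintro (rfl | rfl)
      · exact ⟨hnot i j hij haij _ hx, dominated_insert_of_above hd ha hmin hx hxm⟩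
      · exact ⟨hnot j i hij.symm haij.symm _ hy, dominated_insert_of_above hd ha hmin hy hym⟩
  rw [this, Finset.card_pair hxy]
  exact even_two

/-- If the colours of a set with as many elements as there are colours do not comprise all colours,
then an even number of its elements can be removed so that exactly all colours except `i₀` remain.
-/
theorem even_card_image_erase {I : Type*} [Fintype I] [DecidableEq I] (c : X → I) (i₀ : I)
    {σ : Finset X} (hcard : σ.card = Fintype.card I) (hσ : σ.image c ≠ Finset.univ) :
    Even (σ.filter fun x => (σ.erase x).image c = Finset.univ.erase i₀).card := by
  rcases Finset.eq_empty_or_nonempty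
    (σ.filter fun x => (σ.erase x).image c = Finset.univ.erase i₀) with h | ⟨x, hx⟩
  · simp [h]
  obtain ⟨hxσ, hx⟩ := Finset.mem_filter.1 hx
  have hinj : ∀ z ∈ σ, (σ.erase z).image c = Finset.univ.erase i₀ →
      Set.InjOn c (σ.erase z : Finset X) := fun z hz h => by
    rw [← Finset.card_image_iff, h, Finset.card_erase_of_mem hz,
      Finset.card_erase_of_mem (Finset.mem_univ _), hcard, Finset.card_univ]
  have hcx : c x ∈ (σ.erase x).image c := by
    rw [hx]
    refine Finset.mem_erase.2 ⟨fun hc => hσ ?_, Finset.mem_univ _⟩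
    rw [← Finset.insert_erase hxσ, Finset.image_insert, hx, hc,
      Finset.insert_erase (Finset.mem_univ _)]
  obtain ⟨y, hy, hyx⟩ := Finset.mem_image.1 hcx
  obtain ⟨hne, hyσ⟩ := Finset.mem_erase.1 hy
  have hxy : (σ.erase y).image c = Finset.univ.erase i₀ := by
    rw [← hx]
    have h1 : σ.erase y = insert x ((σ.erase x).erase y) := by
      ext z; simp only [Finset.mem_erase, Finset.mem_insert]
      by_cases hz : z = x
      · subst hz; simp [hne.symm, hxσ]
      · simp [hz]
    have h2 : σ.erase x = insert y ((σ.erase x).erase y) := (Finset.insert_erase hy).symm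
    conv_rhs => rw [h2]
    rw [h1, Finset.image_insert, Finset.image_insert, hyx]
  have : (σ.filter fun x => (σ.erase x).image c = Finset.univ.erase i₀) = {x, y} := by
    ext z
    simp only [Finset.mem_filter, Finset.mem_insert, Finset.mem_singleton]
    constructor
    · rintro ⟨hz, hzc⟩
      by_contra! h
      refine hne (hinj z hz hzc ?_ ?_ hyx) <;> simp [*, h.1.symm, h.2.symm]
    · rintro (rfl | rfl)
      · exact ⟨hxσ, hx⟩
      · exact ⟨hyσ, hxy⟩
  rw [this, Finset.card_pair hne.symm]
  exact even_two

/-- Scarf's lemma. The orders on `T` are extended to `T ⊕ I`: the slack element `Sum.inr i` is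
below `T` in the order of `i` and above `T` in all other orders. If the slack elements have their
own index as their colour, then, for each colouring of `T`, there is a dominated set with an
element of each colour. -/
theorem exists_dominated_image_eq_univ {I T : Type*} [Fintype I] [DecidableEq I] [Fintype T]
    [DecidableEq T] [Nonempty I] [Nonempty T] {r : I → T ⊕ I → ℕ}
    (hr : ∀ i, Function.Injective (r i))
    (hlow : ∀ i t, r i (Sum.inr i) < r i (Sum.inl t))
    (hhigh : ∀ i j t, i ≠ j → r i (Sum.inl t) < r i (Sum.inr j))
    (c : T ⊕ I → I) (hc : ∀ i, c (Sum.inr i) = i) :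
    ∃ σ : Finset (T ⊕ I), Dominated r σ ∧ σ.image c = Finset.univ := by
  classical
  obtain ⟨i₀⟩ := ‹Nonempty I›
  by_contra! hno
  -- Incidences of the sets `τ` whose colours are all but `i₀` with the elements that complete them.
  let D : Finset (Finset (T ⊕ I)) := Finset.univ.filter fun τ =>
    τ.card + 1 = Fintype.card I ∧ τ.image c = Finset.univ.erase i₀
  let R : Finset (Finset (T ⊕ I)) := Finset.univ.filter fun σ =>
    σ.card = Fintype.card I ∧ Dominated r σ
  have hcount : ∑ τ ∈ D, (Finset.univ.filter fun x => x ∉ τ ∧ Dominated r (insert x τ)).card =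
      ∑ σ ∈ R, (σ.filter fun x => (σ.erase x).image c = Finset.univ.erase i₀).card := by
    rw [← Finset.card_sigma, ← Finset.card_sigma]
    refine Finset.card_bij' (fun q _ => ⟨insert q.2 q.1, q.2⟩) (fun q _ => ⟨q.1.erase q.2, q.2⟩)
      ?_ ?_ ?_ ?_
    · rintro ⟨τ, x⟩ h
      simp only [D, R, Finset.mem_sigma, Finset.mem_filter, Finset.mem_univ, true_and] at h ⊢
      obtain ⟨⟨h1, h2⟩, h3, h4⟩ := h
      refine ⟨⟨by rw [Finset.card_insert_of_notMem h3, h1], h4⟩, Finset.mem_insert_self _ _, ?_⟩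
      rw [Finset.erase_insert h3, h2]
    · rintro ⟨σ, x⟩ h
      simp only [D, R, Finset.mem_sigma, Finset.mem_filter, Finset.mem_univ, true_and] at h ⊢
      obtain ⟨⟨h1, h2⟩, h3, h4⟩ := h
      refine ⟨⟨by rw [Finset.card_erase_add_one h3, h1], h4⟩, Finset.notMem_erase _ _, ?_⟩
      rwa [Finset.insert_erase h3]
    · rintro ⟨τ, x⟩ h
      simp only [Finset.mem_sigma, Finset.mem_filter, Finset.mem_univ, true_and] at h
      simp [Finset.erase_insert h.2.1]
    · rintro ⟨σ, x⟩ h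
      simp only [Finset.mem_sigma, Finset.mem_filter] at h
      simp [Finset.insert_erase h.2.1]
  have heven : Even (∑ σ ∈ R, (σ.filter fun x =>
      (σ.erase x).image c = Finset.univ.erase i₀).card) := by
    refine Finset.even_sum _ fun σ hσ => ?_
    simp only [R, Finset.mem_filter, Finset.mem_univ, true_and] at hσ
    exact even_card_image_erase c i₀ hσ.1 (hno σ hσ.2)
  -- The only set of such incidences of odd size is that of the outer face `τ₀`.
  let τ₀ : Finset (T ⊕ I) := (Finset.univ.erase i₀).image Sum.inr
  have hτ₀ : τ₀ ∈ D := by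
    simp only [D, τ₀, Finset.mem_filter, Finset.mem_univ, true_and]
    refine ⟨?_, ?_⟩
    · rw [Finset.card_image_of_injective _ Sum.inr_injective,
        Finset.card_erase_add_one (Finset.mem_univ _), Finset.card_univ]
    · ext i
      simp [hc]
  have hone : (Finset.univ.filter fun x => x ∉ τ₀ ∧ Dominated r (insert x τ₀)).card = 1 := by
    obtain ⟨t, -, ht⟩ := Finset.exists_max_image (Finset.univ : Finset T)
      (fun t => r i₀ (Sum.inl t)) Finset.univ_nonempty
    rw [Finset.card_eq_one]
    refine ⟨Sum.inl t, ?_⟩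
    ext x
    simp only [Finset.mem_filter, Finset.mem_univ, true_and, Finset.mem_singleton]
    -- Only `i₀` can witness the domination of an element of `T`.
    have key : ∀ s x, Dominated r (insert x τ₀) → r i₀ (Sum.inl s) ≤ r i₀ x := by
      intro s x h
      obtain ⟨l, hl⟩ := h (Sum.inl s)
      by_cases hl0 : l = i₀
      · subst hl0
        exact hl x (Finset.mem_insert_self _ _)
      · exact absurd (hl (Sum.inr l) (Finset.mem_insert_of_mem (by simp [τ₀, hl0])))
          (not_le.2 (hlow l s))
    constructor
    · rintro ⟨hx, hd⟩
      rcases x with s | i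
      · exact hr i₀ (le_antisymm (ht s (Finset.mem_univ _)) (key t _ hd))
      · have : i = i₀ := by simpa [τ₀] using hx
        subst this
        exact absurd (key t _ hd) (not_le.2 (hlow i t))
    · rintro rfl
      refine ⟨by simp [τ₀], fun y => ?_⟩
      rcases y with s | i
      · refine ⟨i₀, fun x hx => ?_⟩
        rcases Finset.mem_insert.1 hx with rfl | hx
        · exact ht s (Finset.mem_univ _)
        · obtain ⟨j, hj, rfl⟩ := Finset.mem_image.1 hx
          exact (hhigh i₀ j s (Finset.ne_of_mem_erase hj).symm).le
      · refine ⟨i, fun x hx => ?_⟩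
        rcases x with s | j
        · exact (hlow i s).le
        · by_cases hij : i = j
          · rw [hij]
          · exact ((hlow i t).trans (hhigh i j t hij)).le
  have hrest : ∀ τ ∈ D.erase τ₀,
      Even (Finset.univ.filter fun x => x ∉ τ ∧ Dominated r (insert x τ)).card := by
    intro τ hτ
    obtain ⟨hne, hτ⟩ := Finset.mem_erase.1 hτ
    simp only [D, Finset.mem_filter, Finset.mem_univ, true_and] at hτ
    -- A set `τ ≠ τ₀` with these colours contains an element of `T`.
    obtain ⟨t, ht⟩ : ∃ t, Sum.inl t ∈ τ := by
      by_contra! h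
      refine hne ?_
      ext x
      rcases x with t | i
      · simp [τ₀, h t]
      · have : i ∈ τ.image c ↔ Sum.inr i ∈ τ := by
          rw [Finset.mem_image]
          constructor
          · rintro ⟨x, hx, hxi⟩
            rcases x with t | j
            · exact absurd hx (h t)
            · rw [hc] at hxi
              rwa [← hxi]
          · exact fun hi => ⟨_, hi, hc i⟩
        rw [← this, hτ.2]
        simp [τ₀]
    refine even_card_dominated_insert hr ⟨_, ht⟩ hτ.1 (fun a ha hmin k => ?_) _ (by simp)
    exact ⟨Sum.inr k, fun l hl => (hmin l _ ht).trans_lt (hhigh l k t hl)⟩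
  rw [← hcount, ← Finset.add_sum_erase D _ hτ₀, hone] at heven
  have := Finset.even_sum _ hrest
  rw [Nat.even_add, iff_true_right this] at heven
  exact absurd heven (by decide)

end Scarf

/-! ### Continuous functions on a simplex -/

namespace Scarf

open Filter Topology

/-- Scarf's lemma for the functions `t : I → ℕ` with sum `N`, ordered by each coordinate with ties
broken by an enumeration: for each colouring there are `C ⊆ I` and, for each `i ∈ C`, a function `t
i` of colour `i`, such that the `t i` differ little from each other and almost vanish off `C`. -/
theorem exists_close_of_colouring {I : Type*} [Fintype I] [DecidableEq I] [Nonempty I] (N : ℕ)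
    (c : (I → ℕ) → I) :
    ∃ (C : Finset I) (t : I → I → ℕ), C.Nonempty ∧ (∀ i, ∑ k, t i k = N) ∧ (∀ i ∈ C, c (t i) = i) ∧
      (∀ i ∈ C, ∀ k ∉ C, t i k < Fintype.card I) ∧
      ∀ i ∈ C, ∀ j ∈ C, ∀ k, t i k ≤ t j k + Fintype.card I := by
  classical
  let T := {t : I → ℕ // t ∈ Finset.piAntidiag (Finset.univ : Finset I) N}
  have hT : ∀ t : T, ∑ k, t.1 k = N := fun t => (Finset.mem_piAntidiag.1 t.2).1
  have hmk : ∀ f : I → ℕ, ∑ k, f k = N → f ∈ Finset.piAntidiag (Finset.univ : Finset I) N :=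
    fun f hf => Finset.mem_piAntidiag.2 ⟨hf, fun _ _ => Finset.mem_univ _⟩
  let t₁ : T := ⟨Pi.single (Classical.arbitrary I) N, hmk _ (by simp)⟩
  have : Nonempty T := ⟨t₁⟩
  let e := Fintype.equivFin (T ⊕ I)
  let K := Fintype.card (T ⊕ I)
  -- The rank is lexicographic: first the weight `w`, then the enumeration `e`. The weight of the
  -- slack element `j` is below the weights `1, …, N + 1` of `T` for the index `j`, else above them.
  let w : I → T ⊕ I → ℕ := fun i =>
    Sum.elim (fun t => t.1 i + 1) fun j => if i = j then 0 else N + 2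
  let r : I → T ⊕ I → ℕ := fun i z => w i z * K + e z
  have hlt : ∀ i x y, w i x < w i y → r i x < r i y := by
    intro i x y h
    have h1 : (e x : ℕ) < K := (e x).2
    have h2 : (w i x + 1) * K ≤ w i y * K := Nat.mul_le_mul_right _ h
    have h3 : (w i x + 1) * K = w i x * K + K := by ring
    simp only [r]
    omega
  have hr : ∀ i, Function.Injective (r i) := by
    intro i x y h
    rcases lt_trichotomy (w i x) (w i y) with h' | h' | h'
    · exact absurd h (hlt i x y h').ne
    · simp only [r, h', Nat.add_left_cancel_iff] at h
      exact e.injective (Fin.ext h)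
    · exact absurd h (hlt i y x h').ne'
  have hle : ∀ i x y, r i x ≤ r i y → w i x ≤ w i y := by
    intro i x y h
    by_contra! h'
    exact absurd (hlt i y x h') (not_lt.2 h)
  have hcoord : ∀ (t : T) i, t.1 i ≤ N := fun t i =>
    (Finset.single_le_sum (f := t.1) (fun _ _ => Nat.zero_le _) (Finset.mem_univ i)).trans_eq (hT t)
  obtain ⟨σ, hσ, hσc⟩ := exists_dominated_image_eq_univ hr
    (fun i t => hlt _ _ _ (by simp [w]))
    (fun i j t hij => hlt _ _ _ (by have := hcoord t i; simp [w, hij]; omega))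
    (Sum.elim (fun t => c t.1) id) (fun i => rfl)
  have hz : ∀ i, ∃ z ∈ σ, Sum.elim (fun t : T => c t.1) id z = i := fun i => by
    have : i ∈ σ.image (Sum.elim (fun t : T => c t.1) id) := by rw [hσc]; exact Finset.mem_univ i
    simpa only [Finset.mem_image] using this
  choose z hzσ hzc using hz
  let s : I → T := fun i => Sum.elim id (fun _ => t₁) (z i)
  let C : Finset I := Finset.univ.filter fun i => (z i).isLeft
  have hC : ∀ i ∈ C, z i = Sum.inl (s i) := by
    intro i hi
    obtain ⟨y, hy⟩ := Sum.isLeft_iff.1 (Finset.mem_filter.1 hi).2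
    simp only [s, hy, Sum.elim_inl, id]
  have hC' : ∀ i ∉ C, z i = Sum.inr i := by
    intro i hi
    have : (z i).isRight := by simpa [C] using hi
    obtain ⟨y, hy⟩ := Sum.isRight_iff.1 this
    have := hzc i
    rw [hy] at this ⊢
    exact congrArg _ this
  -- A slack element `Sum.inr i` lies below `T` for `i`, so only indices in `C` can witness
  -- domination.
  have hdom : ∀ y : I → ℕ, ∑ k, y k = N → ∃ i ∈ C, ∀ j ∈ C, y i ≤ (s j).1 i := by
    intro y hy
    obtain ⟨i, hi⟩ := hσ (Sum.inl ⟨y, hmk y hy⟩)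
    have hiC : i ∈ C := by
      by_contra h
      have := hle _ _ _ (hi _ (hC' i h ▸ hzσ i))
      simp [w] at this
    refine ⟨i, hiC, fun j hj => ?_⟩
    have := hle _ _ _ (hi _ (hC j hj ▸ hzσ j))
    simpa [w] using this
  have hCne : C.Nonempty := by
    obtain ⟨i, hi, -⟩ := hdom t₁.1 (hT t₁)
    exact ⟨i, hi⟩
  choose a haC ha using fun i => Finset.exists_min_image C (fun j => (s j).1 i) hCne
  let m : I → ℕ := fun i => (s (a i)).1 i
  have hm : ∀ j ∈ C, ∀ i, m i ≤ (s j).1 i := fun j hj i => ha i j hj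
  -- Otherwise, raising all the minima by one gives a function that is not dominated.
  have hsum : N < ∑ i ∈ C, (m i + 1) := by
    by_contra! h
    obtain ⟨k, hk⟩ := hCne
    let f : I → ℕ := fun i => if i ∈ C then m i + 1 else 0
    have hf : ∑ i, f i = ∑ i ∈ C, (m i + 1) := by
      rw [← Finset.sum_filter]; simp
    obtain ⟨i, hi, hi'⟩ := hdom (f + Pi.single k (N - ∑ i, f i)) (by
      simp only [Pi.add_apply, Finset.sum_add_distrib, Finset.sum_pi_single', Finset.mem_univ,
        if_true]
      omega)
    have := hi' _ (haC i)
    simp only [f, Pi.add_apply, hi, if_true] at this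
    change m i + 1 + _ ≤ m i at this
    omega
  rw [Finset.sum_add_distrib, Finset.sum_const, smul_eq_mul, mul_one] at hsum
  have hCcard : C.card ≤ Fintype.card I := Finset.card_le_univ C
  have hsplit : ∀ j, ∑ i ∈ C, (s j).1 i + ∑ i ∈ Cᶜ, (s j).1 i = N := fun j => by
    rw [Finset.sum_add_sum_compl, hT]
  have hoff : ∀ j ∈ C, ∀ k ∉ C, (s j).1 k < Fintype.card I := by
    intro j hj k hk
    have h1 := hsplit j
    have h2 := Finset.sum_le_sum fun i (_ : i ∈ C) => hm j hj i
    have h3 := Finset.single_le_sum (f := (s j).1) (fun _ _ => Nat.zero_le _)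
      (Finset.mem_compl.2 hk)
    omega
  refine ⟨C, fun i => (s i).1, hCne, fun i => hT _, fun i hi => ?_, hoff, fun i hi j hj k => ?_⟩
  · have := hzc i
    rwa [hC i hi] at this
  · by_cases hk : k ∈ C
    · have h1 := hsplit i
      have h2 := Finset.sum_le_sum fun l (_ : l ∈ C.erase k) => hm i hi l
      rw [← Finset.add_sum_erase C _ hk] at h1 hsum
      have h3 := hm j hj k
      change (s i).1 k ≤ (s j).1 k + Fintype.card I
      omega
    · exact (hoff i hi k hk).le.trans (Nat.le_add_left _ _)

/-- A continuous function on the standard simplex has a point at which each vertex of the carrier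
of the point has a largest value; this is the existence of a symmetric equilibrium, or of a
solution of a variational inequality. Scarf's lemma provides it, in the limit of fine grids, if
each point is coloured by an index at which the function has its largest value. -/
theorem exists_mem_stdSimplex_forall_le {I : Type*} [Fintype I] [Nonempty I] (g : I → (I → ℝ) → ℝ)
    (hg : ∀ i, ContinuousOn (g i) (stdSimplex ℝ I)) :
    ∃ x ∈ stdSimplex ℝ I, ∀ i, x i ≠ 0 → ∀ j, g j x ≤ g i x := by
  classical
  let pt : ℕ → (I → ℕ) → I → ℝ := fun N t k => t k / (N + 1 : ℕ)
  have hmax : ∀ x, ∃ i, ∀ j, g j x ≤ g i x := fun x => by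
    obtain ⟨i, -, hi⟩ := Finset.exists_max_image Finset.univ (fun i => g i x) Finset.univ_nonempty
    exact ⟨i, fun j => hi j (Finset.mem_univ _)⟩
  choose col hcol using hmax
  choose C t hCne hsum hc hoff hclose using fun N =>
    exists_close_of_colouring (N + 1) fun t => col (pt N t)
  have hpt : ∀ N i, pt N (t N i) ∈ stdSimplex ℝ I := fun N i => by
    refine ⟨fun k => by positivity, ?_⟩
    rw [← Finset.sum_div, ← Nat.cast_sum, hsum, div_self (by positivity)]
  -- Some set of indices occurs for infinitely many grids.
  obtain ⟨C₀, hC₀⟩ : ∃ C₀, ∃ᶠ N in atTop, C N = C₀ := by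
    by_contra! h
    obtain ⟨N, hN⟩ := (eventually_all.2 h).exists
    exact hN (C N) rfl
  obtain ⟨φ, hφ, hφC⟩ := extraction_of_frequently_atTop hC₀
  obtain ⟨j₀, hj₀⟩ : C₀.Nonempty := hφC 0 ▸ hCne (φ 0)
  obtain ⟨x, hx, ψ, hψ, hlim⟩ := (isCompact_stdSimplex ℝ I).tendsto_subseq
    (x := fun n => pt (φ n) (t (φ n) j₀)) fun n => hpt _ _
  have hφψ : Tendsto (fun n => φ (ψ n)) atTop atTop := (hφ.comp hψ).tendsto_atTop
  have hsmall : Tendsto (fun n => (Fintype.card I : ℝ) / (φ (ψ n) + 1 : ℕ)) atTop (𝓝 0) :=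
    (tendsto_const_div_atTop_nhds_zero_nat _).comp ((tendsto_add_atTop_nat 1).comp hφψ)
  have hlim' : ∀ j ∈ C₀, Tendsto (fun n => pt (φ (ψ n)) (t (φ (ψ n)) j)) atTop (𝓝 x) := by
    intro j hj
    rw [tendsto_pi_nhds] at hlim ⊢
    intro k
    have hk := hlim k
    have hbd : ∀ n, ∀ i ∈ C₀, ∀ i' ∈ C₀, pt (φ (ψ n)) (t (φ (ψ n)) i) k ≤
        pt (φ (ψ n)) (t (φ (ψ n)) i') k + Fintype.card I / (φ (ψ n) + 1 : ℕ) := by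
      intro n i hi i' hi'
      have := hclose (φ (ψ n)) i (hφC _ ▸ hi) i' (hφC _ ▸ hi') k
      simp only [pt]
      rw [← add_div]
      gcongr
      exact_mod_cast this
    refine tendsto_of_tendsto_of_tendsto_of_le_of_le
      (g := fun n => pt (φ (ψ n)) (t (φ (ψ n)) j₀) k - Fintype.card I / (φ (ψ n) + 1 : ℕ))
      (h := fun n => pt (φ (ψ n)) (t (φ (ψ n)) j₀) k + Fintype.card I / (φ (ψ n) + 1 : ℕ))
      ?_ ?_ (fun n => ?_) fun n => hbd n j hj j₀ hj₀
    · simpa using hk.sub hsmall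
    · simpa using hk.add hsmall
    · exact sub_le_iff_le_add.2 (hbd n j₀ hj₀ j hj)
  refine ⟨x, hx, fun i hi j => ?_⟩
  have hiC : i ∈ C₀ := by
    by_contra h
    refine hi (le_antisymm ?_ (hx.1 i))
    rw [tendsto_pi_nhds] at hlim
    refine le_of_tendsto_of_tendsto (hlim i) hsmall (Eventually.of_forall fun n => ?_)
    have := hoff (φ (ψ n)) j₀ (hφC _ ▸ hj₀) i (hφC (ψ n) ▸ h)
    simp only [Function.comp, pt]
    gcongr
  have hgl : ∀ l, Tendsto (fun n => g l (pt (φ (ψ n)) (t (φ (ψ n)) i))) atTop (𝓝 (g l x)) :=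
    fun l => (hg l x hx).tendsto.comp (tendsto_nhdsWithin_iff.2
      ⟨hlim' i hiC, Eventually.of_forall fun n => hpt _ _⟩)
  refine le_of_tendsto_of_tendsto (hgl j) (hgl i) (Eventually.of_forall fun n => ?_)
  have h1 := hcol (pt (φ (ψ n)) (t (φ (ψ n)) i)) j
  rwa [hc (φ (ψ n)) i (hφC _ ▸ hiC)] at h1

end Scarf

/-! ### Ky Fan's inequality and equilibria -/

/-- Ky Fan's inequality. By compactness, finitely many `y` suffice. On their convex hull, there is
a point `x` that is a convex combination of those `y` at which `Φ x` is largest, and concavity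
bounds this largest value by `Φ x x`. -/
theorem exists_forall_le_zero_of_concaveOn {E : Type*} [AddCommGroup E] [Module ℝ E]
    [TopologicalSpace E] [T2Space E] [ContinuousAdd E] [ContinuousSMul ℝ E] {K : Set E}
    (hK : IsCompact K) (hconv : Convex ℝ K) (hne : K.Nonempty) (Φ : E → E → ℝ)
    (hcont : ∀ y ∈ K, ContinuousOn (fun x => Φ x y) K) (hconc : ∀ x ∈ K, ConcaveOn ℝ K (Φ x))
    (hdiag : ∀ x ∈ K, Φ x x ≤ 0) : ∃ x ∈ K, ∀ y ∈ K, Φ x y ≤ 0 := by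
  classical
  obtain ⟨x, hx, hx'⟩ := hK.inter_iInter_nonempty (fun y : K => K ∩ (fun x => Φ x y) ⁻¹' Set.Iic 0)
    (fun y => (hcont y y.2).preimage_isClosed_of_isClosed hK.isClosed isClosed_Iic) (by
      intro u
      rcases u.eq_empty_or_nonempty with rfl | hu
      · simpa using hne
      -- On the convex hull of finitely many points, use their weights as coordinates.
      have : Nonempty u := hu.to_subtype
      let pt : (u → ℝ) → E := fun w => ∑ i, w i • (i : E)
      have hpt : ∀ w ∈ stdSimplex ℝ u, pt w ∈ K := fun w hw =>
        hconv.sum_mem (fun i _ => hw.1 i) hw.2 fun i _ => i.1.2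
      have hptc : Continuous pt := by fun_prop
      obtain ⟨w, hw, hmax⟩ := Scarf.exists_mem_stdSimplex_forall_le
        (fun (i : u) w => Φ (pt w) i)
        fun i => (hcont i i.1.2).comp hptc.continuousOn hpt
      have hle : ∑ i, w i * Φ (pt w) i ≤ 0 := by
        have := (hconc _ (hpt w hw)).le_map_sum (t := Finset.univ) (w := w)
          (p := fun i : u => (i : E)) (fun i _ => hw.1 i) hw.2 fun i _ => i.1.2
        simp only [smul_eq_mul] at this
        exact this.trans (hdiag _ (hpt w hw))
      refine ⟨pt w, hpt w hw, Set.mem_iInter₂.2 fun y hy => ⟨hpt w hw, ?_⟩⟩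
      calc Φ (pt w) y = ∑ i, w i * Φ (pt w) y := by rw [← Finset.sum_mul, hw.2, one_mul]
        _ ≤ ∑ i, w i * Φ (pt w) i := by
            refine Finset.sum_le_sum fun i _ => ?_
            by_cases h0 : w i = 0
            · simp [h0]
            · exact mul_le_mul_of_nonneg_left (hmax i h0 ⟨y, hy⟩) (hw.1 i)
        _ ≤ 0 := hle)
  exact ⟨x, hx, fun y hy => (Set.mem_iInter.1 hx' ⟨y, hy⟩).2⟩

/-- A game with compact convex strategy sets has a pure equilibrium if the costs are continuous and
the cost to each player is convex in the player's own strategy. It is a point `S` at which the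
Nikaido–Isoda function `∑ j, (G j S - G j (update S j (R j)))` is at most `0` for all `R`. -/
theorem exists_equilibrium_of_convexOn {ι : Type*} [Fintype ι] [DecidableEq ι] {E : ι → Type*}
    [∀ j, AddCommGroup (E j)] [∀ j, Module ℝ (E j)] [∀ j, TopologicalSpace (E j)]
    [∀ j, T2Space (E j)] [∀ j, ContinuousAdd (E j)] [∀ j, ContinuousSMul ℝ (E j)]
    {K : ∀ j, Set (E j)} (hK : ∀ j, IsCompact (K j)) (hconv : ∀ j, Convex ℝ (K j))
    (hne : ∀ j, (K j).Nonempty) (G : ι → (∀ j, E j) → ℝ)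
    (hcont : ∀ j, ContinuousOn (G j) (Set.univ.pi K))
    (hG : ∀ j, ∀ S ∈ Set.univ.pi K, ConvexOn ℝ (K j) fun R => G j (Function.update S j R)) :
    ∃ S ∈ Set.univ.pi K, ∀ j, ∀ R ∈ K j, G j S ≤ G j (Function.update S j R) := by
  have hup : ∀ S ∈ Set.univ.pi K, ∀ j, ∀ R ∈ K j, Function.update S j R ∈ Set.univ.pi K := by
    intro S hS j R hR i _
    rcases eq_or_ne i j with rfl | h
    · simpa using hR
    · simpa [h] using hS i trivial
  obtain ⟨S, hS, hmin⟩ := exists_forall_le_zero_of_concaveOn (isCompact_univ_pi hK)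
    (convex_pi fun j _ => hconv j) (Set.univ_pi_nonempty_iff.2 hne)
    (fun S R => ∑ j, (G j S - G j (Function.update S j (R j))))
    (fun R hR => continuousOn_finsetSum _ fun j _ => (hcont j).sub
      ((hcont j).comp (by fun_prop) fun S hS => hup S hS j (R j) (hR j trivial)))
    (fun S hS => by
      refine ⟨convex_pi fun j _ => hconv j, fun R hR R' hR' a b ha hb hab => ?_⟩
      simp only [smul_eq_mul, Finset.mul_sum, ← Finset.sum_add_distrib]
      refine Finset.sum_le_sum fun j _ => ?_
      have := (hG j S hS).2 (hR j trivial) (hR' j trivial) ha hb hab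
      simp only [smul_eq_mul, Pi.add_apply, Pi.smul_apply] at this ⊢
      linear_combination this + (G j S) * hab)
    (fun S hS => by simp)
  refine ⟨S, hS, fun j R hR => ?_⟩
  have := hmin (Function.update S j R) (hup S hS j R hR)
  rw [Finset.sum_eq_single j (fun i _ hi => by simp [hi]) (by simp)] at this
  simpa using this

/-! ### Policies of a store -/

open Filter Topology

namespace Store

theorem traded_eq_max (s : Store) (x : ℝ) : s.traded x = max x (s.efficiency * x) := by
  have h0 := s.efficiency_pos
  have h1 := s.efficiency_le_one
  unfold traded
  split_ifs with h
  · rw [max_eq_left]; nlinarith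
  · rw [max_eq_right]; nlinarith

theorem continuous_traded (s : Store) : Continuous s.traded := by
  rw [funext s.traded_eq_max]
  fun_prop

theorem convexOn_traded (s : Store) : ConvexOn ℝ Set.univ s.traded := by
  rw [funext s.traded_eq_max]
  exact (convexOn_id convex_univ).sup ((convexOn_id convex_univ).smul s.efficiency_pos.le)

/-- The initial and the final level need not lie between `0` and the capacity, so the bounding box
has to take them into account. -/
theorem isCompact_feasible (s : Store) (T : ℕ) : IsCompact (s.feasible T) := by
  have hclosed : IsClosed (s.feasible T) := by
    simp only [feasible, levelChange, Set.mem_Icc, Set.ofPred_and, Set.ofPred_forall]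
    refine (isClosed_eq (by fun_prop) (by fun_prop)).inter
      ((isClosed_eq (by fun_prop) (by fun_prop)).inter (.inter ?_ ?_))
    · refine isClosed_iInter fun t => isClosed_iInter fun _ => isClosed_iInter fun _ => .inter ?_ ?_
      · exact isClosed_le (by fun_prop) (by fun_prop)
      · exact isClosed_le (by fun_prop) (by fun_prop)
    · refine isClosed_iInter fun t => .inter ?_ ?_
      · exact isClosed_le (by fun_prop) (by fun_prop)
      · exact isClosed_le (by fun_prop) (by fun_prop)
  refine (isCompact_univ_pi fun _ : Fin (T + 1) => isCompact_Icc
    (a := min 0 (min s.initialLevel s.finalLevel))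
    (b := max s.capacity (max s.initialLevel s.finalLevel))).of_isClosed_subset hclosed ?_
  rintro S ⟨h0, hT, hS, -⟩ t -
  by_cases ht : t = 0
  · subst ht
    rw [h0]
    exact ⟨by simp, by simp⟩
  by_cases ht' : t = Fin.last T
  · subst ht'
    rw [hT]
    exact ⟨by simp, by simp⟩
  · exact ⟨(min_le_left _ _).trans (hS t ht ht').1, (hS t ht ht').2.trans (le_max_left _ _)⟩

end Store

theorem levelChange_add_smul {T : ℕ} (a b : ℝ) (R S : Fin (T + 1) → ℝ) (t : Fin T) :
    levelChange (a • R + b • S) t = a * levelChange R t + b * levelChange S t := by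
  simp only [levelChange, Pi.add_apply, Pi.smul_apply, smul_eq_mul]
  ring

theorem Store.convex_feasible (s : Store) (T : ℕ) : Convex ℝ (s.feasible T) := by
  rintro R ⟨hR0, hRT, hR, hR'⟩ S ⟨hS0, hST, hS, hS'⟩ a b ha hb hab
  refine ⟨?_, ?_, fun t h0 hT => ?_, fun t => ?_⟩
  · simp only [Pi.add_apply, Pi.smul_apply, hR0, hS0, ← add_smul, hab, one_smul]
  · simp only [Pi.add_apply, Pi.smul_apply, hRT, hST, ← add_smul, hab, one_smul]
  · exact convex_Icc _ _ (hR t h0 hT) (hS t h0 hT) ha hb hab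
  · rw [levelChange_add_smul]
    exact convex_Icc _ _ (hR' t) (hS' t) ha hb hab

/-! ### Costs in the market -/

section

variable {n T : ℕ} {store : Fin n → Store}

theorem traded_mem_tradeRange {j : Fin n} {R : Fin (T + 1) → ℝ} (hR : R ∈ (store j).feasible T)
    (t : Fin T) : (store j).traded (levelChange R t) ∈ tradeRange store {j} := by
  obtain ⟨h1, h2⟩ := hR.2.2.2 t
  have := (store j).efficiency_pos
  have := (store j).inputRate_nonneg
  have := (store j).outputRate_nonneg
  simp only [tradeRange, Finset.sum_singleton, Store.traded]
  split_ifs with h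
  · exact ⟨by nlinarith, h2⟩
  · exact ⟨by nlinarith, by nlinarith⟩

theorem sum_mem_tradeRange (A : Finset (Fin n)) {z : Fin n → ℝ}
    (hz : ∀ i, z i ∈ tradeRange store {i}) : ∑ i ∈ A, z i ∈ tradeRange store A := by
  simp only [tradeRange, Finset.sum_singleton, Set.mem_Icc] at hz ⊢
  rw [← Finset.sum_neg_distrib]
  exact ⟨Finset.sum_le_sum fun i _ => (hz i).1, Finset.sum_le_sum fun i _ => (hz i).2⟩

theorem add_mem_tradeRange {j : Fin n} {x k : ℝ} (hx : x ∈ tradeRange store {j})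
    (hk : k ∈ tradeRange store (Finset.univ.erase j)) : x + k ∈ tradeRange store Finset.univ := by
  simp only [tradeRange, Finset.sum_singleton, Set.mem_Icc] at hx hk ⊢
  rw [← Finset.add_sum_erase _ _ (Finset.mem_univ j),
    ← Finset.add_sum_erase _ _ (Finset.mem_univ j)]
  constructor <;> linarith [hx.1, hx.2, hk.1, hk.2]

namespace PriceAssumptions

variable {p : ℝ → ℝ}

/-- The price is continuous at each total purchase to which some store contributes a non-zero
amount that is interior to its range, since a convex function is continuous in the interior. -/
theorem continuousAt (hp : PriceAssumptions store p) {j : Fin n} {x y : ℝ}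
    (hx : x ∈ interior (tradeRange store {j})) (hx0 : x ≠ 0)
    (hy : y - x ∈ tradeRange store (Finset.univ.erase j)) : ContinuousAt p y := by
  have h1 : ContinuousAt (fun x' => x' * p (x' + (y - x))) x :=
    (hp.cost_convex j _ hy).continuousOn_interior.continuousAt (isOpen_interior.mem_nhds hx)
  have h2 : ContinuousAt (fun x' => p (x' + (y - x))) x := by
    refine (h1.div continuousAt_id hx0).congr ?_
    filter_upwards [continuousAt_id.eventually_ne hx0] with x' hx'
    exact mul_div_cancel_left₀ _ hx'
  have h3 : ContinuousAt (fun y' => y' - (y - x)) y := by fun_prop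
  have h4 := ContinuousAt.comp (x := y) (f := fun y' => y' - (y - x))
    (g := fun x' => p (x' + (y - x))) (by simpa using h2) h3
  simpa [Function.comp_def] using h4

/-- The price is continuous, on its range, at each total purchase to which some store contributes a
non-zero amount. If this amount is an end point of the range of the store, then part of it can be
shifted to the other stores, except at the end points of the whole range; continuity at the lower
end point follows from the monotonicity of the price and of the cost. -/
theorem continuousWithinAt (hp : PriceAssumptions store p)
    (hcont : ContinuousWithinAt p (tradeRange store Finset.univ) (∑ j, (store j).inputRate))
    {j : Fin n} {x k : ℝ} (hx : x ∈ tradeRange store {j})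
    (hk : k ∈ tradeRange store (Finset.univ.erase j)) (hx0 : x ≠ 0) :
    ContinuousWithinAt p (tradeRange store Finset.univ) (x + k) := by
  have hA := Finset.add_sum_erase Finset.univ (fun i => (store i).efficiency * (store i).outputRate)
    (Finset.mem_univ j)
  have hB := Finset.add_sum_erase Finset.univ (fun i => (store i).inputRate) (Finset.mem_univ j)
  have ha : 0 ≤ (store j).efficiency * (store j).outputRate :=
    mul_nonneg (store j).efficiency_pos.le (store j).outputRate_nonneg
  have hb := (store j).inputRate_nonneg
  have hxk := add_mem_tradeRange hx hk
  have hint : ∀ x', -((store j).efficiency * (store j).outputRate) < x' →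
      x' < (store j).inputRate → x' ∈ interior (tradeRange store {j}) := by
    intro x' h1 h2
    simpa [tradeRange, interior_Icc] using And.intro h1 h2
  have hx' := hx
  have hk' := hk
  simp only [tradeRange, Finset.sum_singleton, Set.mem_Icc] at hx' hk' hA hB
  rcases lt_or_gt_of_ne hx0 with hneg | hpos
  · rcases eq_or_lt_of_le hxk.1 with hy | hy
    -- At the lower end point `x + k`, with `y ↓ x + k`, the price is squeezed by
    -- `p (x + k) ≤ p y ≤ x * p (x + k) / (y - k)`.
    · have hxa : x = -((store j).efficiency * (store j).outputRate) := by linarith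
      have hlim : Tendsto (fun y => x * p (x + k) / (y - k))
          (𝓝[tradeRange store Finset.univ] (x + k)) (𝓝 (p (x + k))) := by
        have : ContinuousAt (fun y => x * p (x + k) / (y - k)) (x + k) :=
          continuousAt_const.div (by fun_prop) (by simpa using hx0)
        have h := this.tendsto
        simp only [add_sub_cancel_right, mul_div_cancel_left₀ _ hx0] at h
        exact h.mono_left nhdsWithin_le_nhds
      refine tendsto_of_tendsto_of_tendsto_of_le_of_le' tendsto_const_nhds hlim ?_ ?_
      · filter_upwards [self_mem_nhdsWithin] with y hyI
        exact hp.mono hxk hyI (hy ▸ hyI.1)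
      · have hlt : ∀ᶠ y in 𝓝 (x + k), y < k := gt_mem_nhds (by linarith)
        filter_upwards [self_mem_nhdsWithin, nhdsWithin_le_nhds hlt] with y hyI hyk
        have hyx : x + k ≤ y := hy ▸ hyI.1
        have hmem : y - k ∈ tradeRange store {j} := by
          simp only [tradeRange, Finset.sum_singleton, Set.mem_Icc]
          constructor <;> linarith
        have := hp.cost_mono j k hk hx hmem (by linarith)
        simp only [sub_add_cancel] at this
        rw [le_div_iff_of_neg (by linarith)]
        linarith
    -- Otherwise `x` can be raised, staying negative, while the other stores buy less.
    · have hk1 : -∑ i ∈ Finset.univ.erase j, (store i).efficiency * (store i).outputRate ≤ k :=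
        hk'.1
      refine (hp.continuousAt (j := j) (x := min (x + k + ∑ i ∈ Finset.univ.erase j,
        (store i).efficiency * (store i).outputRate) (x / 2))
        (hint _ ?_ ?_) ?_ ?_).continuousWithinAt
      · refine lt_min ?_ ?_ <;> linarith [hx'.1]
      · exact (min_le_right _ _).trans_lt (by linarith)
      · exact ((min_le_right _ _).trans_lt (by linarith)).ne
      · simp only [tradeRange, Set.mem_Icc]
        have h1 := min_le_left (x + k + ∑ i ∈ Finset.univ.erase j,
          (store i).efficiency * (store i).outputRate) (x / 2)
        have h2 : x ≤ min (x + k + ∑ i ∈ Finset.univ.erase j,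
          (store i).efficiency * (store i).outputRate) (x / 2) := le_min (by linarith) (by linarith)
        constructor <;> linarith [hk'.2]
  · rcases eq_or_lt_of_le hxk.2 with hy | hy
    · rwa [hy]
    -- Here `x` can be lowered, staying positive, while the other stores buy more.
    · refine (hp.continuousAt (j := j) (x := max (x + k - ∑ i ∈ Finset.univ.erase j,
        (store i).inputRate) (x / 2))
        (hint _ ?_ ?_) ?_ ?_).continuousWithinAt
      · exact lt_of_lt_of_le (by linarith) (le_max_right _ _)
      · refine max_lt ?_ ?_ <;> linarith [hx'.2]
      · exact (lt_of_lt_of_le (by linarith) (le_max_right _ _)).ne'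
      · simp only [tradeRange, Set.mem_Icc]
        have h1 := le_max_left (x + k - ∑ i ∈ Finset.univ.erase j, (store i).inputRate) (x / 2)
        have h2 : max (x + k - ∑ i ∈ Finset.univ.erase j, (store i).inputRate) (x / 2) ≤ x :=
          max_le (by linarith [hk'.2]) (by linarith)
        constructor <;> linarith [hk'.1]

/-- The cost to a store is a continuous function of all amounts traded. The price may jump at a
total purchase to which no store contributes, but there the cost is small since the price is
bounded. -/
theorem continuousOn_cost (hp : PriceAssumptions store p)
    (hcont : ContinuousWithinAt p (tradeRange store Finset.univ) (∑ j, (store j).inputRate))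
    (j : Fin n) :
    ContinuousOn (fun z : Fin n → ℝ => z j * p (∑ i, z i))
      (Set.univ.pi fun i => tradeRange store {i}) := by
  intro z hz
  have hmem : ∀ z ∈ Set.univ.pi (fun i => tradeRange store {i}),
      ∑ i, z i ∈ tradeRange store Finset.univ :=
    fun z hz => sum_mem_tradeRange _ fun i => hz i trivial
  have hsum : Continuous fun z : Fin n → ℝ => ∑ i, z i := by fun_prop
  by_cases h0 : z j = 0
  · let B := ∑ i, (store i).inputRate
    have hB : B ∈ tradeRange store Finset.univ :=
      Set.right_mem_Icc.2 ((hmem z hz).1.trans (hmem z hz).2)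
    have hlim : Tendsto (fun z' : Fin n → ℝ => |z' j| * p B)
        (𝓝[Set.univ.pi fun i => tradeRange store {i}] z) (𝓝 0) := by
      have : Continuous fun z' : Fin n → ℝ => |z' j| * p B := by fun_prop
      have h := this.tendsto z
      simp only [h0, abs_zero, zero_mul] at h
      exact h.mono_left nhdsWithin_le_nhds
    rw [ContinuousWithinAt, h0, zero_mul]
    refine squeeze_zero_norm' ?_ hlim
    filter_upwards [self_mem_nhdsWithin] with z' hz'
    rw [norm_mul, Real.norm_eq_abs, Real.norm_eq_abs, abs_of_pos (hp.pos _ (hmem z' hz'))]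
    exact mul_le_mul_of_nonneg_left (hp.mono (hmem z' hz') hB (hmem z' hz').2) (abs_nonneg _)
  · refine (continuous_apply j).continuousWithinAt.mul ?_
    have h := hp.continuousWithinAt hcont (hz j trivial)
      (sum_mem_tradeRange (Finset.univ.erase j) fun i => hz i trivial) h0
    rw [Finset.add_sum_erase _ _ (Finset.mem_univ j)] at h
    exact h.comp hsum.continuousWithinAt hmem

end PriceAssumptions

variable {p : Fin T → ℝ → ℝ}

theorem continuousOn_totalCost (hp : ∀ t, PriceAssumptions store (p t))
    (hcont : ∀ t, ContinuousWithinAt (p t) (tradeRange store Finset.univ)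
      (∑ j, (store j).inputRate)) (j : Fin n) :
    ContinuousOn (totalCost store p j) (Set.univ.pi fun i => (store i).feasible T) := by
  refine continuousOn_finsetSum _ fun t _ => ?_
  refine ((hp t).continuousOn_cost (hcont t) j).comp
    (f := fun (S : Fin n → Fin (T + 1) → ℝ) i => (store i).traded (levelChange (S i) t)) ?_
    fun S hS i _ => traded_mem_tradeRange (hS i trivial) t
  refine (continuous_pi fun i => (store i).continuous_traded.comp ?_).continuousOn
  unfold levelChange
  fun_prop

/-- The cost to a store is convex in its own policy: the amount it trades is a convex function of
its change of level, and the cost of trading is convex and increasing. -/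
theorem convexOn_totalCost_update (hp : ∀ t, PriceAssumptions store (p t)) (j : Fin n)
    {S : Fin n → Fin (T + 1) → ℝ} (hS : S ∈ Set.univ.pi fun i => (store i).feasible T) :
    ConvexOn ℝ ((store j).feasible T) fun R => totalCost store p j (Function.update S j R) := by
  refine ⟨(store j).convex_feasible T, fun R hR R' hR' a b ha hb hab => ?_⟩
  simp only [totalCost, smul_eq_mul, Finset.mul_sum, ← Finset.sum_add_distrib]
  refine Finset.sum_le_sum fun t _ => ?_
  set k := ∑ i ∈ Finset.univ.erase j, (store i).traded (levelChange (S i) t) with hk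
  have hkm : k ∈ tradeRange store (Finset.univ.erase j) :=
    sum_mem_tradeRange _ fun i => traded_mem_tradeRange (hS i trivial) t
  have hcost : ∀ R : Fin (T + 1) → ℝ,
      periodCost store (p t) j (fun i => levelChange (Function.update S j R i) t) =
        (store j).traded (levelChange R t) * p t ((store j).traded (levelChange R t) + k) := by
    intro R
    rw [periodCost, ← Finset.add_sum_erase _ _ (Finset.mem_univ j), Function.update_self, hk]
    congr 3
    refine Finset.sum_congr rfl fun i hi => ?_
    rw [Function.update_of_ne (Finset.ne_of_mem_erase hi)]
  simp only [hcost]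
  have hconv := hp t |>.cost_convex j k hkm
  have hRt := traded_mem_tradeRange hR t
  have hRt' := traded_mem_tradeRange hR' t
  refine le_trans ?_ (hconv.2 hRt hRt' ha hb hab)
  refine (hp t).cost_mono j k hkm
    (traded_mem_tradeRange ((store j).convex_feasible T hR hR' ha hb hab) t)
    (hconv.1 hRt hRt' ha hb hab) ?_
  rw [levelChange_add_smul]
  exact (store j).convexOn_traded.2 trivial trivial ha hb hab

end

theorem mainTheorem3 (n T : ℕ) (store : Fin n → Store) (p : Fin T → ℝ → ℝ)
    (hfeas : ∀ j, ((store j).feasible T).Nonempty)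
    (hp : ∀ t, PriceAssumptions store (p t))
    (hcont : ∀ t, ContinuousWithinAt (p t) (tradeRange store Finset.univ)
      (∑ j, (store j).inputRate)) :
    ∃ S : Fin n → Fin (T + 1) → ℝ, IsNashEquilibrium store p S := by
  obtain ⟨S, hS, hmin⟩ := exists_equilibrium_of_convexOn
    (fun j => (store j).isCompact_feasible T) (fun j => (store j).convex_feasible T) hfeas
    (totalCost store p) (fun j => continuousOn_totalCost hp hcont j)
    fun j _ hS => convexOn_totalCost_update hp j hS
  exact ⟨S, fun j => ⟨hS j trivial, hmin j⟩⟩
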